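/- A triangular polyhedron is a finite two-dimensional abstract simplicial complex in which every edge belongs to exactly two triangles and whose $1$-skeleton (the graph formed by its vertices and edges) is connected. Let $G=(V,E)$ be the $1$-skeleton of a triangular polyhedron. Let $\rho\colon V\to\mathbb{R}^3$ be a realization, i.e. a map with $\rho(u)\neq\rho(v)$ for every $\{u,v\}\in E$, with induced edge lengths $\lambda_{\{u,v\}}=\|\rho(u)-\rho(v)\|$ for $\{u,v\}\in E$ (Euclidean norm). Suppose that $G$ with the realization $\rho$ admits a flex $f$, i.e. a continuous map $f\colon[0,1)\to(\mathbb{R}^3)^V$ such that $f(0)=\rho$, such that for every $t\in[0,1)$ the maps $f(t)$ and $f(0)$ induce the same edge lengths, and such that for any two distinct $t_1,t_2\in[0,1)$ there is no isometry $\sigma$ of $\mathbb{R}^3$ with $f(t_1)=\sigma\circ f(t_2)$. Let $\{w_1,w_2\}$ be an edge of $G$ and let $s$ and $n$ be the two vertices opposite to this edge in the two triangles containing it. Suppose that the dihedral angle between the faces $\{w_1,w_2,s\}$ and $\{w_1,w_2,n\}$ is not constant along the flex $f$ (in particular, these two faces are realized as nondegenerate triangles, so that the angle is defined). Then $G$ contains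 an induced cycle $C$ (a cycle such that every edge of $G$ joining two vertices of $C$ is an edge of $C$) that contains the edge $\{w_1,w_2\}$ but neither the vertex $s$ nor the vertex $n$, and there are signs $\eta_e\in\{1,-1\}$, for $e$ an edge of $C$, such that \[ \sum_{e\in E(C)}\eta_e\,\lambda_e=0 . \] -/

import Mathlib

/-- Euclidean three-space. -/
abbrev E3 : Type := EuclideanSpace ℝ (Fin 3)

/-- The `1`-skeleton of an abstract simplicial complex: the graph of its vertices and edges. -/
def oneSkeleton {V : Type*} [DecidableEq V] (K : AbstractSimplicialComplex V) :
    SimpleGraph V where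
  Adj u v := u ≠ v ∧ ({u, v} : Finset V) ∈ K.faces
  symm := ⟨fun u v h => ⟨h.1.symm, by rw [Finset.pair_comm]; exact h.2⟩⟩
  loopless := ⟨fun _ h => h.1 rfl⟩

/-- An abstract simplicial complex (on a vertex type that is finite wherever this predicate is
used) is a triangular polyhedron if it has dimension two, every edge belongs to exactly two
triangles, and the `1`-skeleton is connected. -/
structure IsTriangularPolyhedron {V : Type*} [DecidableEq V]
    (K : AbstractSimplicialComplex V) : Prop where
  card_le_three : ∀ t ∈ K.faces, t.card ≤ 3
  exists_triangle : ∃ t ∈ K.faces, t.card = 3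
  edge_in_two_triangles : ∀ e ∈ K.faces, e.card = 2 →
    {t : Finset V | t ∈ K.faces ∧ t.card = 3 ∧ e ⊆ t}.ncard = 2
  connected : (oneSkeleton K).Connected

/-- `x` completes the pair `u, v` to a triangle of `K`; for an edge `{u, v}` this means that `x`
is the vertex opposite to the edge in one of the triangles containing it. -/
def IsOppositeVertex {V : Type*} [DecidableEq V] (K : AbstractSimplicialComplex V)
    (u v x : V) : Prop :=
  x ≠ u ∧ x ≠ v ∧ ({u, v, x} : Finset V) ∈ K.faces

/-- A realization maps adjacent vertices to distinct points of three-space. -/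
def IsRealization {V : Type*} (G : SimpleGraph V) (ρ : V → E3) : Prop :=
  ∀ u v, G.Adj u v → ρ u ≠ ρ v

/-- The length of the (potential) edge `e` induced by the point configuration `ρ`. -/
noncomputable def edgeLength {V : Type*} (ρ : V → E3) : Sym2 V → ℝ :=
  Sym2.lift ⟨fun u v => ‖ρ u - ρ v‖, fun u v => norm_sub_rev (ρ u) (ρ v)⟩

/-- Two configurations are congruent if they differ by an isometry of three-space
(orientation-reversing isometries are allowed). -/
def Congruent3 {V : Type*} (ρ₁ ρ₂ : V → E3) : Prop :=
  ∃ σ : E3 ≃ᵢ E3, ρ₁ = σ ∘ ρ₂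

/-- A flex of the graph `G` with realization `ρ`: a continuous family of configurations,
parametrized by `[0, 1)`, starting at `ρ`, preserving all edge lengths, and pairwise
noncongruent. -/
structure IsFlex {V : Type*} (G : SimpleGraph V) (ρ : V → E3)
    (f : Set.Ico (0 : ℝ) 1 → V → E3) : Prop where
  continuous : Continuous f
  start : f 0 = ρ
  edgeLength_eq : ∀ t, ∀ e ∈ G.edgeSet, edgeLength (f t) e = edgeLength (f 0) e
  not_congruent : ∀ t₁ t₂, t₁ ≠ t₂ → ¬ Congruent3 (f t₁) (f t₂)

/-- The component of `a - p` orthogonal to the direction `q - p`; for `p ≠ q` this is the vector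
from the foot of the perpendicular dropped from `a` onto the line `pq` to `a`. -/
noncomputable def altitude (p q a : E3) : E3 :=
  (a - p) - (inner ℝ (q - p) (a - p) / inner ℝ (q - p) (q - p)) • (q - p)

/-- The dihedral angle, in `[0, π]`, at the edge `pq` between the triangles `p q a` and `p q b`:
the angle between the half-planes bounded by the line `pq` through `a` and through `b`.
It is meaningful when both triangles are nondegenerate. If one of them is degenerate, the
corresponding altitude vector is zero and the value is `π / 2`; as a flex preserves the side
lengths of triangles, and hence degeneracy, the value is then constant along the flex. -/
noncomputable def dihedralAngle (p q a b : E3) : ℝ :=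
  InnerProductGeometry.angle (altitude p q a) (altitude p q b)

/-! ### Finite and infinite points in isotropic coordinates -/

section ValuedPoints

variable {K Γ : Type*} [Field K] [LinearOrderedCommGroupWithZero Γ] (v : Valuation K Γ)

/-! Move the triangle `w₁ w₂ s` to a fixed position, with `w₁ w₂` on the first axis. Then `n` runs
through infinitely many points of a circle around that axis. In coordinates `x`, `p = y + iz`, `q =
y - iz`, squared length is `x² + pq`. A valuation trivial on constants with a pole at `p n`
(`exists_degeneration`) sends `n` to an isotropic point at infinity, while `w₁`, `w₂`, `s` stay
finite.

Let `F` be the finite vertices, `N` those tending to the same point as `n`, and `U` the vertices of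
`F` with `q` infinitesimal. A vertex of `F` adjacent to `N` lies in `U`, and being in `N` propagates
between adjacent infinite vertices with a common neighbour in `U` (`TendsToIsotropic.of_adjacent`).
On `U` the term `pq` contributes nothing to lengths up to infinitesimals, so an edge length is `±`
the difference of the `x`-coordinates. Around a cycle in `U` these differences telescope, and a real
number that is infinitesimal is zero.

Such a cycle through `w₁ w₂` exists because the edges separating `F` from `N` in the surface have no
bridge: a parity count of triangles with two vertices in `F` and one in `N`
(`reachable_induceDeleteEdge`). A shortest detour makes it induced. It misses `n`, which is
infinite, and `s`, whose `q` is a nonzero constant. -/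

theorem Valuation.lt_mul_of_lt_of_le_one {a b : K} {g : Γ} (ha : v a < g) (hb : v b ≤ 1) :
    v (b * a) < g := by
  rw [map_mul]
  calc v b * v a ≤ 1 * v a := by gcongr
    _ = v a := one_mul _
    _ < g := ha

/-- The coordinates `x, p, q` (with quadratic form `x ^ 2 + p * q`) of a point without poles. -/
structure IsFinitePoint (x p q : K) : Prop where
  x : v x ≤ 1
  p : v p ≤ 1
  q : v q ≤ 1

/-- The coordinates `x, p, q` of a point which tends to infinity in the isotropic direction of `p`,
more precisely to the point `(0 : 0 : 1 : 0 : 0)` of the quadric with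
coordinates `(1 : x : p : q : x ^ 2 + p * q)`. -/
structure TendsToIsotropic (x p q : K) : Prop where
  one_lt : 1 < v p
  x_lt : v x < v p
  q_lt : v q < v p
  form_lt : v (x ^ 2 + p * q) < v p

variable {v}

/-- In the expanded distance equation every term other than `q * p'` is of smaller order than `p'`.
Geometrically, the finite point lies on the tangent hyperplane of the quadric at the isotropic
point. -/
theorem IsFinitePoint.q_lt_one_of_tendsToIsotropic {x p q x' p' q' c : K}
    (hu : IsFinitePoint v x p q) (hy : TendsToIsotropic v x' p' q') (hc : v c ≤ 1)
    (h : (x - x') ^ 2 + (p - p') * (q - q') = c) : v q < 1 := by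
  have hp : 0 < v p' := zero_lt_one.trans hy.one_lt
  have e : q * p' = (x' ^ 2 + p' * q') - x * x' - x * x' + x * x + p * q - p * q' - c := by
    rw [← h]; ring
  have h1 : v (q * p') < v p' := by
    rw [e]
    refine v.map_sub_lt (v.map_sub_lt (v.map_add_lt (v.map_add_lt (v.map_sub_lt (v.map_sub_lt
      hy.form_lt ?_) ?_) ?_) ?_) ?_) (hc.trans_lt hy.one_lt)
    · exact v.lt_mul_of_lt_of_le_one hy.x_lt hu.x
    · exact v.lt_mul_of_lt_of_le_one hy.x_lt hu.x
    · exact v.lt_mul_of_lt_of_le_one (hu.x.trans_lt hy.one_lt) hu.x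
    · exact v.lt_mul_of_lt_of_le_one (hu.q.trans_lt hy.one_lt) hu.p
    · exact v.lt_mul_of_lt_of_le_one hy.q_lt hu.p
  rw [map_mul] at h1
  by_contra hcon
  exact absurd h1 (not_lt.2 (by simpa using mul_le_mul_left (not_lt.1 hcon) (v p')))

/-- Let `M` be the largest order among `x', p', q'`. The distance to the finite point makes the
quadratic form linear in these, so of order at most `M`. The distance to the isotropic point then
forces `q'` below `M`, and the form forces `x'` below `M`. Hence `p'` dominates. -/
theorem TendsToIsotropic.of_adjacent {x₀ p₀ q₀ x p q x' p' q' c₁ c₂ : K}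
    (hu : IsFinitePoint v x₀ p₀ q₀) (hq : v q₀ < 1) (hy : TendsToIsotropic v x p q)
    (hinf : ¬ IsFinitePoint v x' p' q') (hc₁ : v c₁ ≤ 1) (hc₂ : v c₂ ≤ 1)
    (h₁ : (x₀ - x') ^ 2 + (p₀ - p') * (q₀ - q') = c₁)
    (h₂ : (x - x') ^ 2 + (p - p') * (q - q') = c₂) : TendsToIsotropic v x' p' q' := by
  obtain ⟨M, hM1, hxM, hpM, hqM, hM⟩ : ∃ M : Γ, 1 < M ∧ v x' ≤ M ∧ v p' ≤ M ∧ v q' ≤ M ∧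
      (M = v x' ∨ M = v p' ∨ M = v q') := by
    refine ⟨max (v x') (max (v p') (v q')), ?_, by simp, by simp, by simp, ?_⟩
    · by_contra hcon
      simp only [lt_max_iff, not_or, not_lt] at hcon
      exact hinf ⟨hcon.1, hcon.2.1, hcon.2.2⟩
    · grind
  have hM0 : 0 < M := zero_lt_one.trans hM1
  have hp1 := hy.one_lt
  have hp0 : 0 < v p := zero_lt_one.trans hp1
  have hMpM : M < v p * M := by simpa using (mul_lt_mul_iff_left₀ hM0).2 hp1
  have hppM : v p < v p * M := by simpa using (mul_lt_mul_iff_right₀ hp0).2 hM1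
  have fin_mul {a b : K} (ha : v a ≤ 1) (hb : v b ≤ M) : v (a * b) ≤ M := by
    rw [map_mul]; simpa using mul_le_mul' ha hb
  have eQ : x' ^ 2 + p' * q' =
      x₀ * x' + x₀ * x' + p₀ * q' + q₀ * p' - x₀ * x₀ - p₀ * q₀ + c₁ := by
    rw [← h₁]; ring
  have fin_sq {a b : K} (ha : v a ≤ 1) (hb : v b ≤ 1) : v (a * b) ≤ 1 := by
    rw [map_mul]; simpa using mul_le_mul' ha hb
  have hQ : v (x' ^ 2 + p' * q') ≤ M := by
    rw [eQ]
    refine v.map_add_le (v.map_sub_le (v.map_sub_le (v.map_add_le (v.map_add_le (v.map_add_le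
      ?_ ?_) ?_) ?_) ?_) ?_) (hc₁.trans hM1.le)
    · exact fin_mul hu.x hxM
    · exact fin_mul hu.x hxM
    · exact fin_mul hu.p hqM
    · exact fin_mul hu.q hpM
    · exact (fin_sq hu.x hu.x).trans hM1.le
    · exact (fin_sq hu.p hu.q).trans hM1.le
  have small_mul {a b : K} (ha : v a < v p) (hb : v b ≤ M) : v (a * b) < v p * M := by
    rw [map_mul]
    calc v a * v b ≤ v a * M := by gcongr
      _ < v p * M := (mul_lt_mul_iff_left₀ hM0).2 ha
  have hqM' : v q' < M := by
    have e : p * q' = (x ^ 2 + p * q) + (x' ^ 2 + p' * q') - x * x' - x * x' - q * p' - c₂ := by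
      rw [← h₂]; ring
    have h1 : v (p * q') < v p * M := by
      rw [e]
      refine v.map_sub_lt (v.map_sub_lt (v.map_sub_lt (v.map_sub_lt (v.map_add_lt
        ?_ ?_) ?_) ?_) ?_) ?_
      · exact hy.form_lt.trans hppM
      · exact hQ.trans_lt hMpM
      · exact small_mul hy.x_lt hxM
      · exact small_mul hy.x_lt hxM
      · exact small_mul hy.q_lt hpM
      · exact hc₂.trans_lt (hp1.trans hppM)
    rw [map_mul] at h1
    exact (mul_lt_mul_iff_right₀ hp0).1 h1
  have hMM : M < M * M := by simpa using (mul_lt_mul_iff_left₀ hM0).2 hM1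
  have hxM' : v x' < M := by
    have h1 : v (x' * x') < M * M := by
      have e : x' * x' = (x' ^ 2 + p' * q') - p' * q' := by ring
      rw [e]
      refine v.map_sub_lt (hQ.trans_lt hMM) ?_
      rw [map_mul]
      calc v p' * v q' ≤ M * v q' := by gcongr
        _ < M * M := (mul_lt_mul_iff_right₀ hM0).2 hqM'
    rw [map_mul] at h1
    by_contra hcon
    exact absurd h1 (not_lt.2 (mul_le_mul' (not_lt.1 hcon) (not_lt.1 hcon)))
  have hpM' : M = v p' := by
    rcases hM with h | h | h
    · exact absurd h hxM'.ne'
    · exact h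
    · exact absurd h hqM'.ne'
  subst hpM'
  refine ⟨hM1, hxM', hqM', ?_⟩
  rw [eQ]
  refine v.map_add_lt (v.map_sub_lt (v.map_sub_lt (v.map_add_lt (v.map_add_lt (v.map_add_lt
    ?_ ?_) ?_) ?_) ?_) ?_) (hc₁.trans_lt hM1)
  · exact v.lt_mul_of_lt_of_le_one hxM' hu.x
  · exact v.lt_mul_of_lt_of_le_one hxM' hu.x
  · exact v.lt_mul_of_lt_of_le_one hqM' hu.p
  -- The term `q₀ * p'` is the only one of possible order `M`, and `hq` makes it smaller.
  · rw [map_mul]; simpa using (mul_lt_mul_iff_left₀ hM0).2 hq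
  · exact (fin_sq hu.x hu.x).trans_lt hM1
  · exact (fin_sq hu.p hu.q).trans_lt hM1

/-- Two finite points on the tangent hyperplane at the isotropic point at infinity have, up to sign,
the distance of their `x`-coordinates. -/
theorem IsFinitePoint.exists_unit_sub_lt_one {x p q x' p' q' l : K}
    (hu : IsFinitePoint v x p q) (hq : v q < 1) (hu' : IsFinitePoint v x' p' q') (hq' : v q' < 1)
    (h : (x - x') ^ 2 + (p - p') * (q - q') = l ^ 2) :
    ∃ ε : ℤˣ, v (((ε : ℤ) : K) * l - (x - x')) < 1 := by
  -- A difference of squares equal to an infinitesimal: one of the two factors must be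
  -- infinitesimal.
  have h1 : v ((l - (x - x')) * (-l - (x - x'))) < 1 := by
    have e : (l - (x - x')) * (-l - (x - x')) = -((p - p') * (q - q')) := by
      linear_combination h
    rw [e, Valuation.map_neg]
    exact v.lt_mul_of_lt_of_le_one (v.map_sub_lt hq hq') (v.map_sub_le hu.p hu'.p)
  by_contra! hcon
  have ha := hcon 1
  have hb := hcon (-1)
  simp only [Units.val_one, Int.cast_one, one_mul, Units.val_neg, Int.cast_neg, neg_mul] at ha hb
  rw [map_mul] at h1
  exact absurd h1 (not_lt.2 (by simpa using mul_le_mul' ha hb))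

end ValuedPoints

/-! ### Existence of the degeneration -/

section Place

/-- A complex valued function with infinitely many values has a pole at a place that is trivial on
the constants of an ultrapower of the complex numbers. -/
theorem exists_place_of_infinite_range {T : Type} {g : T → ℂ} (hg : (Set.range g).Infinite) :
    ∃ (φ : Ultrafilter T) (V : ValuationSubring (Filter.Germ (φ : Filter T) ℂ)),
      (∀ c : ℂ, ((fun _ => c : T → ℂ) : Filter.Germ (φ : Filter T) ℂ) ∈ V) ∧
      (g : Filter.Germ (φ : Filter T) ℂ) ∉ V := by
  -- An ultrafilter below this filter makes `g` avoid each constant eventually, so its germ is not a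
  -- constant.
  have hne : (Filter.comap g Filter.cofinite).NeBot := by
    rw [Filter.comap_neBot_iff]
    intro s hs
    obtain ⟨z, ⟨t, rfl⟩, hz⟩ := hg.exists_notMem_finite (Filter.mem_cofinite.1 hs)
    exact ⟨t, not_not.1 hz⟩
  let φ : Ultrafilter T := Ultrafilter.of (Filter.comap g Filter.cofinite)
  let ι : ℂ →+* Filter.Germ (φ : Filter T) ℂ :=
    (Filter.Germ.coeRingHom (φ : Filter T)).comp (Pi.constRingHom T ℂ)
  have hgι : (g : Filter.Germ (φ : Filter T) ℂ) ∉ ι.range := by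
    rintro ⟨c, hc⟩
    have h1 : (fun _ => c) =ᶠ[(φ : Filter T)] g := Filter.Germ.coe_eq.1 hc
    have h2 : ∀ᶠ t in (φ : Filter T), g t ≠ c := by
      have h3 : {c}ᶜ ∈ (Filter.cofinite : Filter ℂ) := (Set.finite_singleton c).compl_mem_cofinite
      exact Ultrafilter.of_le _ (Filter.preimage_mem_comap (m := g) h3)
    obtain ⟨t, ht, ht'⟩ := (h1.and h2).exists
    exact ht' ht.symm
  -- Monic polynomials over `ℂ` split, so their roots in the ultrapower are already constants. An
  -- integrally closed subring is an intersection of valuation rings, and one of these omits `g`.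
  have hclosed : IsIntegrallyClosedIn ι.range (Filter.Germ (φ : Filter T) ℂ) := by
    rw [Subring.isIntegrallyClosedIn_iff]
    rintro x ⟨P, hP, hx⟩
    obtain ⟨Q, hQ⟩ := Polynomial.map_surjective ι.rangeRestrict ι.rangeRestrict_surjective P
    have hQx : Q.eval₂ ι x = 0 := by
      rw [← hQ, Polynomial.eval₂_map] at hx
      exact hx
    have hQ0 : Q ≠ 0 := by
      rintro rfl
      rw [Polynomial.map_zero] at hQ
      exact hP.ne_zero hQ.symm
    have hs : (Q.map ι).Splits := (IsAlgClosed.splits Q).map ι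
    have hroot : x ∈ (Q.map ι).roots := by
      rw [Polynomial.mem_roots ((Polynomial.map_ne_zero_iff ι.injective).2 hQ0),
        Polynomial.IsRoot, Polynomial.eval_map, hQx]
    rw [(IsAlgClosed.splits Q).roots_map] at hroot
    obtain ⟨c, -, hc⟩ := Multiset.mem_map.1 hroot
    exact ⟨c, hc⟩
  obtain ⟨V, hV, hgV⟩ := Subring.exists_le_valuationSubring_of_isIntegrallyClosedIn hgι
  exact ⟨φ, V, fun c => hV ⟨c, rfl⟩, hgV⟩

/-- Motions of a framework along which the vertex `n` attains infinitely many positions on a circle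
around the first axis have a degeneration in which `n` tends to infinity. -/
theorem exists_degeneration {T : Type} {W : Type*} (G : SimpleGraph W)
    (X Y Z : W → T → ℝ) (l : Sym2 W → ℝ)
    (hl : ∀ u v, G.Adj u v → ∀ t,
      (X u t - X v t) ^ 2 + (Y u t - Y v t) ^ 2 + (Z u t - Z v t) ^ 2 = l s(u, v) ^ 2)
    {n s : W} {a b r : ℝ} (hXn : ∀ t, X n t = a) (hYZ : ∀ t, Y n t ^ 2 + Z n t ^ 2 = b)
    (hY : (Set.range (Y n)).Infinite) (hr : r ≠ 0) (hYs : ∀ t, Y s t = r) (hZs : ∀ t, Z s t = 0) :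
    ∃ (K Γ : Type) (_ : Field K) (_ : LinearOrderedCommGroupWithZero Γ) (v : Valuation K Γ)
      (ι : ℝ →+* K) (x p q : W → K), (∀ c, v (ι c) ≤ 1) ∧
      (∀ u v, G.Adj u v → (x u - x v) ^ 2 + (p u - p v) * (q u - q v) = ι (l s(u, v)) ^ 2) ∧
      TendsToIsotropic v (x n) (p n) (q n) ∧ v (q s) = 1 ∧
      ∀ w : W, (∃ c, ∀ t, X w t = c) → (∃ c, ∀ t, Y w t = c) → (∀ t, Z w t = 0) →
        IsFinitePoint v (x w) (p w) (q w) := by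
  have hg : (Set.range fun t => (⟨Y n t, Z n t⟩ : ℂ)).Infinite := by
    refine Set.Infinite.of_image Complex.re ?_
    rwa [← Set.range_comp]
  obtain ⟨φ, V, hV, hgV⟩ := exists_place_of_infinite_range hg
  let κ : ℂ →+* Filter.Germ (φ : Filter T) ℂ :=
    (Filter.Germ.coeRingHom (φ : Filter T)).comp (Pi.constRingHom T ℂ)
  let γ := Filter.Germ.coeRingHom (R := ℂ) (φ : Filter T)
  let v := V.valuation
  let x : W → T → ℂ := fun w t => X w t
  let p : W → T → ℂ := fun w t => ⟨Y w t, Z w t⟩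
  let q : W → T → ℂ := fun w t => ⟨Y w t, -Z w t⟩
  -- Constants have no poles; applied to inverses, this makes nonzero constants units.
  have hκ (c : ℂ) : v (κ c) ≤ 1 := (V.valuation_le_one_iff _).2 (hV c)
  have hκ1 {c : ℂ} (hc : c ≠ 0) : v (κ c) = 1 := by
    refine le_antisymm (hκ c) ?_
    calc (1 : V.ValueGroup) = v (κ c) * v (κ c⁻¹) := by
          rw [← map_mul, ← map_mul, mul_inv_cancel₀ hc, map_one, map_one]
      _ ≤ v (κ c) * 1 := by gcongr; exact hκ _
      _ = v (κ c) := mul_one _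
  have hp : 1 < v (γ (p n)) := by
    rw [← not_le, V.valuation_le_one_iff]
    exact hgV
  have hx : γ (x n) = κ a := congrArg γ (funext fun t => by simp [x, hXn t])
  have hpq : γ (p n) * γ (q n) = κ b := by
    rw [← map_mul]
    refine congrArg γ (funext fun t => ?_)
    apply Complex.ext
    · simp [p, q, ← hYZ t, pow_two]
    · simp [p, q]; ring
  refine ⟨_, _, inferInstance, inferInstance, v, κ.comp Complex.ofRealHom, fun w => γ (x w),
    fun w => γ (p w), fun w => γ (q w), fun c => hκ c, ?_, ?_, ?_, ?_⟩
  · intro u w huw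
    simp only [← map_sub, ← map_mul, ← map_pow, ← map_add]
    change _ = κ _
    refine congrArg γ (funext fun t => ?_)
    have := hl u w huw t
    apply Complex.ext
    · simp [p, q, x, pow_two] at this ⊢; linarith
    · simp [p, q, x, pow_two]; ring
  · refine ⟨hp, ?_, ?_, ?_⟩
    · change v (γ (x n)) < _
      rw [hx]
      exact (hκ a).trans_lt hp
    · have h1 : v (γ (p n)) * v (γ (q n)) ≤ 1 := by rw [← map_mul, hpq]; exact hκ b
      refine lt_of_not_ge fun hcon => ?_
      exact absurd h1 (not_le.2 (one_lt_mul'' hp (hp.trans_le hcon)))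
    · change v (γ (x n) ^ 2 + γ (p n) * γ (q n)) < _
      rw [hpq, hx, ← map_pow, ← map_add]
      exact (hκ _).trans_lt hp
  · have : γ (q s) = κ r := congrArg γ (funext fun t => by
      apply Complex.ext <;> simp [q, hYs t, hZs t])
    change v (γ (q s)) = 1
    rw [this]
    exact hκ1 (by exact_mod_cast hr)
  · rintro w ⟨c, hc⟩ ⟨d, hd⟩ hz
    have h1 : γ (x w) = κ c := congrArg γ (funext fun t => by simp [x, hc t])
    have h2 : γ (p w) = κ d := congrArg γ (funext fun t => by
      apply Complex.ext <;> simp [p, hd t, hz t])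
    have h3 : γ (q w) = κ d := congrArg γ (funext fun t => by
      apply Complex.ext <;> simp [q, hd t, hz t])
    refine ⟨?_, ?_, ?_⟩
    · change v (γ (x w)) ≤ 1; rw [h1]; exact hκ _
    · change v (γ (p w)) ≤ 1; rw [h2]; exact hκ _
    · change v (γ (q w)) ≤ 1; rw [h3]; exact hκ _

end Place

/-! ### Induced cycles from shortest paths -/

section Graphs

namespace SimpleGraph

variable {V : Type*} {G : SimpleGraph V}

/-- A chord skipping a vertex would shorten the walk below the distance. -/
theorem Walk.mem_edges_of_length_eq_dist {u v : V} (p : G.Walk u v) (hp : p.length = G.dist u v)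
    {a b : V} (ha : a ∈ p.support) (hb : b ∈ p.support) (hab : G.Adj a b) : s(a, b) ∈ p.edges := by
  obtain ⟨i, rfl, hi⟩ := Walk.mem_support_iff_exists_getVert.1 ha
  obtain ⟨j, rfl, hj⟩ := Walk.mem_support_iff_exists_getVert.1 hb
  have key : ∀ i j, i < j → j ≤ p.length → G.Adj (p.getVert i) (p.getVert j) →
      s(p.getVert i, p.getVert j) ∈ p.edges := by
    intro i j hij hj hab
    have hd := G.dist_le ((p.take i).append (Walk.cons hab (p.drop j)))
    simp only [Walk.length_append, Walk.length_cons, Walk.take_length, Walk.drop_length] at hd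
    have : j = i + 1 := by omega
    subst this
    rw [Walk.mk_mem_edges_iff_exists]
    exact ⟨i, by omega, rfl⟩
  rcases lt_trichotomy i j with h | h | h
  · exact key i j h hj hab
  · subst h; exact absurd rfl hab.ne
  · rw [Sym2.eq_swap]; exact key j i h hi hab.symm

/-- The subgraph induced on `U`, without the edge `e`. -/
def induceDeleteEdge (G : SimpleGraph V) (U : Set V) (e : Sym2 V) : SimpleGraph V where
  Adj a b := G.Adj a b ∧ a ∈ U ∧ b ∈ U ∧ s(a, b) ≠ e
  symm := ⟨fun a b h => ⟨h.1.symm, h.2.2.1, h.2.1, by rw [Sym2.eq_swap]; exact h.2.2.2⟩⟩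
  loopless := ⟨fun _ h => h.1.ne rfl⟩

/-- Close a shortest path from `b` to `a` with the deleted edge. Any other chord would be an edge of
the reduced graph joining two vertices of that path. -/
theorem exists_induced_cycle {U : Set V} {a b : V} (ha : a ∈ U) (hab : G.Adj a b)
    (h : (G.induceDeleteEdge U s(a, b)).Reachable b a) :
    ∃ c : G.Walk a a, c.IsCycle ∧ c.toSubgraph.IsInduced ∧ s(a, b) ∈ c.edges ∧
      ∀ x ∈ c.support, x ∈ U := by
  obtain ⟨p, hp⟩ := h.exists_walk_length_eq_dist
  have hle : G.induceDeleteEdge U s(a, b) ≤ G := fun _ _ h => h.1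
  have hedges : s(a, b) ∉ p.edges := fun hm => (p.adj_of_mem_edges hm).2.2.2 rfl
  have hU : ∀ x ∈ p.support, x ∈ U := by
    have : ∀ {y z : V} (p : (G.induceDeleteEdge U s(a, b)).Walk y z), z ∈ U →
        ∀ x ∈ p.support, x ∈ U := by
      intro y z p hz
      induction p with
      | nil => simpa using hz
      | cons h q ih =>
        intro x hx
        rcases List.mem_cons.1 (Walk.support_cons h q ▸ hx) with rfl | hx
        · exact h.2.1
        · exact ih hz x hx
    exact this p ha
  refine ⟨Walk.cons hab (p.mapLe hle), ?_, ?_, by simp, ?_⟩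
  · rw [Walk.cons_isCycle_iff]
    exact ⟨(p.isPath_of_length_eq_dist hp).mapLe hle, by simpa using hedges⟩
  · intro x hx y hy hxy
    have hx' : x ∈ p.support := by
      have : (x = a ∨ x = b) ∨ x ∈ p.support := by simpa using hx
      rcases this with (rfl | rfl) | h
      · exact p.end_mem_support
      · exact p.start_mem_support
      · exact h
    have hy' : y ∈ p.support := by
      have : (y = a ∨ y = b) ∨ y ∈ p.support := by simpa using hy
      rcases this with (rfl | rfl) | h
      · exact p.end_mem_support
      · exact p.start_mem_support
      · exact h
    rw [← Subgraph.mem_edgeSet, Walk.mem_edges_toSubgraph]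
    by_cases he : s(x, y) = s(a, b)
    · simp [he]
    · have := p.mem_edges_of_length_eq_dist hp hx' hy' ⟨hxy, hU x hx', hU y hy', he⟩
      simpa using Or.inr this
  · intro x hx
    have : x = a ∨ x ∈ p.support := by simpa using hx
    rcases this with rfl | h
    · exact ha
    · exact hU x h

end SimpleGraph

end Graphs

/-! ### Signed length sums along walks -/

section SignedSum

variable {V K Γ : Type*} [Field K] [LinearOrderedCommGroupWithZero Γ] {v : Valuation K Γ}

/-- The differences of `x` telescope. As no edge repeats, the sign chosen at each step can be
recorded as a function of the edge. -/
theorem exists_signs_of_walk {G : SimpleGraph V} {U : Set V} (ι : ℝ →+* K) (l : Sym2 V → ℝ)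
    (x : V → K)
    (h : ∀ a ∈ U, ∀ b ∈ U, G.Adj a b →
      ∃ ε : ℤˣ, v (((ε : ℤ) : K) * ι (l s(a, b)) - (x a - x b)) < 1)
    {a b : V} (c : G.Walk a b) (hc : c.edges.Nodup) (hU : ∀ y ∈ c.support, y ∈ U) :
    ∃ ε : Sym2 V → ℤˣ,
      v (ι (c.edges.map fun e => ((ε e : ℤ) : ℝ) * l e).sum - (x a - x b)) < 1 := by
  classical
  induction c with
  | nil => exact ⟨1, by simp⟩
  | @cons a d b had p ih =>
    rw [SimpleGraph.Walk.edges_cons, List.nodup_cons] at hc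
    obtain ⟨ε, hε⟩ := ih hc.2 fun y hy => hU y (by simp [hy])
    obtain ⟨η, hη⟩ := h a (hU a (by simp)) d (hU d (by simp)) had
    refine ⟨Function.update ε s(a, d) η, ?_⟩
    have e1 : (p.edges.map fun e => ((Function.update ε s(a, d) η e : ℤ) : ℝ) * l e) =
        p.edges.map fun e => ((ε e : ℤ) : ℝ) * l e := by
      refine List.map_congr_left fun e he => ?_
      rw [Function.update_of_ne (by rintro rfl; exact hc.1 he)]
    rw [SimpleGraph.Walk.edges_cons, List.map_cons, List.sum_cons, e1, Function.update_self,
      map_add, map_mul, map_intCast]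
    have := v.map_add_lt hη hε
    convert this using 2
    ring

/-- On a closed walk the telescoped difference vanishes, leaving a real number of value less than
one. Were it nonzero, multiplying by its inverse would give `1 < 1`. -/
theorem exists_zero_sum_signs {G : SimpleGraph V} {U : Set V} (ι : ℝ →+* K)
    (hι : ∀ c, v (ι c) ≤ 1) (l : Sym2 V → ℝ) (x : V → K)
    (h : ∀ a ∈ U, ∀ b ∈ U, G.Adj a b →
      ∃ ε : ℤˣ, v (((ε : ℤ) : K) * ι (l s(a, b)) - (x a - x b)) < 1)
    {a : V} (c : G.Walk a a) (hc : c.edges.Nodup) (hU : ∀ y ∈ c.support, y ∈ U) :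
    ∃ ε : Sym2 V → ℤˣ, (c.edges.map fun e => ((ε e : ℤ) : ℝ) * l e).sum = 0 := by
  obtain ⟨ε, hε⟩ := exists_signs_of_walk ι l x h c hc hU
  refine ⟨ε, ?_⟩
  rw [sub_self, sub_zero] at hε
  by_contra hne
  have := v.lt_mul_of_lt_of_le_one hε (hι (c.edges.map fun e => ((ε e : ℤ) : ℝ) * l e).sum⁻¹)
  rw [← map_mul, inv_mul_cancel₀ hne, map_one, map_one] at this
  exact lt_irrefl _ this

end SignedSum

/-! ### Parity of triangles between `F` and `N` -/

theorem sum_sum_eq_zero_of_symmetric {α : Type*} {S : Finset α} {g : α → α → ZMod 2}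
    (hsymm : ∀ a b, g a b = g b a) (hdiag : ∀ a, g a a = 0) :
    ∑ a ∈ S, ∑ b ∈ S, g a b = 0 := by
  rw [← Finset.sum_product']
  refine Finset.sum_involution (fun c _ => (c.2, c.1)) ?_ ?_ ?_ ?_
  · rintro ⟨a, b⟩ _
    rw [hsymm b a]
    exact CharTwo.add_self_eq_zero _
  · rintro ⟨a, b⟩ _ hne he
    simp only [Prod.mk.injEq] at he
    exact hne (by rw [he.1]; exact hdiag _)
  · rintro ⟨a, b⟩ h
    simpa [and_comm] using h
  · rintro ⟨a, b⟩ _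
    rfl

section Separation

variable {V : Type*} [DecidableEq V] {K : AbstractSimplicialComplex V}

theorem AbstractSimplicialComplex.pair_mem_of_triple_mem {x y z : V}
    (h : ({x, y, z} : Finset V) ∈ K.faces) : ({x, y} : Finset V) ∈ K.faces :=
  (K.isRelLowerSet_faces h).2 (by intro a; simp; tauto) (by simp)

theorem IsTriangularPolyhedron.card_opposite_eq_two [Fintype V] (hK : IsTriangularPolyhedron K)
    {x y : V} (h : (oneSkeleton K).Adj x y) (S : Finset V)
    (hS : ∀ z, z ∈ S ↔ IsOppositeVertex K x y z) : S.card = 2 := by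
  rw [← hK.edge_in_two_triangles _ h.2 (Finset.card_pair h.1), ← Set.ncard_coe_finset]
  refine Set.ncard_congr (fun z _ => ({x, y, z} : Finset V)) ?_ ?_ ?_
  · intro z hz
    obtain ⟨hzx, hzy, hz⟩ := (hS z).1 hz
    refine ⟨hz, Finset.card_eq_three.2 ⟨x, y, z, h.1, hzx.symm, hzy.symm, rfl⟩, ?_⟩
    intro a; simp; tauto
  · intro z z' hz hz' he
    obtain ⟨hzx, hzy, hz⟩ := (hS z).1 hz
    have : z ∈ ({x, y, z'} : Finset V) := he ▸ by simp
    simpa [hzx, hzy] using this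
  · rintro t ⟨ht, hcard, hsub⟩
    have h1 : (t \ {x, y}).card = 1 := by
      rw [Finset.card_sdiff_of_subset hsub, hcard, Finset.card_pair h.1]
    obtain ⟨z, hz⟩ := Finset.card_eq_one.1 h1
    have hzt : z ∈ t \ {x, y} := hz ▸ Finset.mem_singleton_self z
    have e : ({x, y, z} : Finset V) = t := by
      rw [← Finset.union_sdiff_of_subset hsub, hz]
      ext a; simp
    simp only [Finset.mem_sdiff, Finset.mem_insert, Finset.mem_singleton, not_or] at hzt
    exact ⟨z, (hS z).2 ⟨hzt.2.1, hzt.2.2, e ▸ ht⟩, e⟩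

open Classical in
/-- The indicator function modulo two of the triangles of `K`. -/
noncomputable def triangleIndicator (K : AbstractSimplicialComplex V) (x y z : V) : ZMod 2 :=
  if x ≠ y ∧ IsOppositeVertex K x y z then 1 else 0

theorem triangleIndicator_ne_zero {x y z : V} (h : triangleIndicator K x y z ≠ 0) :
    x ≠ y ∧ x ≠ z ∧ y ≠ z ∧ ({x, y, z} : Finset V) ∈ K.faces := by
  unfold triangleIndicator at h
  split_ifs at h with h'
  · exact ⟨h'.1, h'.2.1.symm, h'.2.2.1.symm, h'.2.2.2⟩
  · exact absurd rfl h

theorem triangleIndicator_swap_left (x y z : V) :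
    triangleIndicator K x y z = triangleIndicator K y x z := by
  unfold triangleIndicator IsOppositeVertex
  rw [Finset.insert_comm x y {z}]
  congr 1
  grind

theorem triangleIndicator_swap_right (x y z : V) :
    triangleIndicator K x y z = triangleIndicator K x z y := by
  unfold triangleIndicator IsOppositeVertex
  rw [Finset.pair_comm y z]
  congr 1
  grind

theorem triangleIndicator_self_left (x z : V) : triangleIndicator K x x z = 0 := by
  simp [triangleIndicator]

theorem triangleIndicator_self_right (x y : V) : triangleIndicator K x y y = 0 := by
  simp [triangleIndicator, IsOppositeVertex]

theorem adj_of_triangleIndicator_ne_zero {x y z : V} (h : triangleIndicator K x y z ≠ 0) :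
    (oneSkeleton K).Adj x y ∧ (oneSkeleton K).Adj x z ∧ (oneSkeleton K).Adj y z := by
  have key : ∀ {x y z : V}, triangleIndicator K x y z ≠ 0 → (oneSkeleton K).Adj x y := fun h =>
    let h' := triangleIndicator_ne_zero h
    ⟨h'.1, AbstractSimplicialComplex.pair_mem_of_triple_mem h'.2.2.2⟩
  refine ⟨key h, key (triangleIndicator_swap_right x y z ▸ h), ?_⟩
  rw [triangleIndicator_swap_left, triangleIndicator_swap_right] at h
  exact key h

/-- The two triangles at an edge cancel modulo two, so triangles form a cycle mod 2. -/
theorem IsTriangularPolyhedron.sum_triangleIndicator [Fintype V] (hK : IsTriangularPolyhedron K)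
    (x y : V) : ∑ z, triangleIndicator K x y z = 0 := by
  classical
  by_cases hxy : (oneSkeleton K).Adj x y
  · have h2 := hK.card_opposite_eq_two hxy {z | IsOppositeVertex K x y z} (by simp)
    simp only [triangleIndicator, ne_eq, hxy.1, not_false_eq_true, true_and,
      Finset.sum_boole, h2]
    rfl
  · refine Finset.sum_eq_zero fun z _ => ?_
    by_contra h
    exact hxy (adj_of_triangleIndicator_ne_zero h).1

/-- The link of a set `N` of vertices within a set `F` of vertices has no bridges, provided that
`N` consists of all vertices outside of `F` close to each other as seen from `F`. -/
theorem IsTriangularPolyhedron.reachable_induceDeleteEdge [Fintype V]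
    (hK : IsTriangularPolyhedron K) {F N U : Set V} (hFN : Disjoint F N) (hUF : U ⊆ F)
    (hU : ∀ u ∈ F, ∀ y ∈ N, (oneSkeleton K).Adj u y → u ∈ U)
    (hN : ∀ u ∈ F, ∀ y ∈ N, ∀ x, x ∉ F → (oneSkeleton K).Adj u y → (oneSkeleton K).Adj u x →
      (oneSkeleton K).Adj y x → x ∈ N)
    {w₁ w₂ s n : V} (hw : (oneSkeleton K).Adj w₁ w₂) (hs : IsOppositeVertex K w₁ w₂ s)
    (hn : IsOppositeVertex K w₁ w₂ n) (hw₁F : w₁ ∈ F) (hw₂F : w₂ ∈ F) (hsF : s ∈ F)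
    (hnN : n ∈ N) :
    ((oneSkeleton K).induceDeleteEdge U s(w₁, w₂)).Reachable w₂ w₁ := by
  classical
  by_contra hcon
  set H := (oneSkeleton K).induceDeleteEdge U s(w₁, w₂)
  let F' : Finset V := {x | x ∈ F}
  let N' : Finset V := {x | x ∈ N}
  let R : Finset V := {x | H.Reachable w₂ x}
  let τ := triangleIndicator K
  have hRF : R ⊆ F' := by
    intro x hx
    have hx : H.Reachable w₂ x := by simpa [R] using hx
    obtain ⟨p⟩ := hx.symm
    cases p with
    | nil => simpa [F'] using hw₂F
    | cons h q => simpa [F'] using hUF h.2.1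
  -- Weight a pair `u x` in `F` by its number of triangles with apex in `N`; each `u` has even total
  -- weight. For fixed `y ∈ N`, the triangles at `u y` have third vertex in `F` or `N` by `hN` and
  -- are even in number. Those with third vertex in `N` cancel in pairs after summing over `y`.
  have heven : ∀ u ∈ F', ∑ x ∈ F', ∑ y ∈ N', τ u x y = 0 := by
    intro u hu
    have hu : u ∈ F := by simpa [F'] using hu
    have hsum : ∀ y ∈ N', ∑ x ∈ F', τ u x y = - ∑ x ∈ N', τ u x y := by
      intro y hy
      have hy : y ∈ N := by simpa [N'] using hy
      have hd : Disjoint F' N' := by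
        rw [Finset.disjoint_left]
        intro x hx hx'
        exact Set.disjoint_left.1 hFN (by simpa [F'] using hx) (by simpa [N'] using hx')
      rw [eq_neg_iff_add_eq_zero, ← Finset.sum_union hd, ← hK.sum_triangleIndicator u y]
      rw [← Finset.sum_subset (Finset.subset_univ (F' ∪ N'))]
      · exact Finset.sum_congr rfl fun x _ => triangleIndicator_swap_right _ _ _
      · intro x _ hx
        by_contra hne
        have hadj := adj_of_triangleIndicator_ne_zero hne
        refine hx (Finset.mem_union.2 ?_)
        by_cases hxF : x ∈ F
        · exact Or.inl (by simpa [F'] using hxF)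
        · exact Or.inr (by simpa [N'] using hN u hu y hy x hxF hadj.1 hadj.2.1 hadj.2.2)
    rw [Finset.sum_comm, Finset.sum_congr rfl hsum, Finset.sum_neg_distrib,
      sum_sum_eq_zero_of_symmetric (g := fun y x => τ u x y)
        (fun _ _ => triangleIndicator_swap_right _ _ _)
        (fun _ => triangleIndicator_self_right _ _), neg_zero]
  -- A pair of nonzero weight is an edge within `U`, so only the deleted edge can leave the
  -- component `R` of `w₂`.
  have hleave : ∀ u ∈ R, ∀ x ∈ F' \ R, ∑ y ∈ N', τ u x y ≠ 0 → u = w₂ ∧ x = w₁ := by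
    intro u hu x hx hne
    obtain ⟨y, hy, hne⟩ := Finset.exists_ne_zero_of_sum_ne_zero hne
    have hy : y ∈ N := by simpa [N'] using hy
    have hadj := adj_of_triangleIndicator_ne_zero hne
    rw [Finset.mem_sdiff] at hx
    have hxF : x ∈ F := by simpa [F'] using hx.1
    have huF : u ∈ F := by simpa [F'] using hRF hu
    have hu' : H.Reachable w₂ u := by simpa [R] using hu
    have hx' : ¬ H.Reachable w₂ x := by simpa [R] using hx.2
    by_contra hnot
    refine hx' (hu'.trans (SimpleGraph.Adj.reachable ⟨hadj.1, hU u huF y hy hadj.2.1,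
      hU x hxF y hy hadj.2.2, ?_⟩))
    intro he
    rcases Sym2.eq_iff.1 he with ⟨rfl, rfl⟩ | h
    · exact hcon hu'
    · exact hnot h
  have hw₂R : w₂ ∈ R := by simp [R]
  have hw₁R : w₁ ∈ F' \ R := by simp [R, F', hw₁F, hcon]
  -- Of the two vertices opposite to `w₁ w₂`, only `n` is in `N`, as `s` is in `F`.
  have hone : ∑ y ∈ N', τ w₂ w₁ y = 1 := by
    rw [Finset.sum_eq_single n]
    · rw [show τ w₂ w₁ n = triangleIndicator K w₁ w₂ n from triangleIndicator_swap_left _ _ _]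
      simp [triangleIndicator, hw.1, hn]
    · intro y hy hyn
      have hy : y ∈ N := by simpa [N'] using hy
      by_contra hne
      have hne : triangleIndicator K w₁ w₂ y ≠ 0 := triangleIndicator_swap_left (K := K) w₁ w₂ y ▸ hne
      have hy' : IsOppositeVertex K w₁ w₂ y := by
        obtain ⟨h1, h2, h3, h4⟩ := triangleIndicator_ne_zero hne
        exact ⟨h2.symm, h3.symm, h4⟩
      have h2 := hK.card_opposite_eq_two hw {z | IsOppositeVertex K w₁ w₂ z} (by simp)
      have h3 : ({s, n, y} : Finset V) ⊆ ({z | IsOppositeVertex K w₁ w₂ z} : Finset V) := by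
        intro z hz
        simp only [Finset.mem_insert, Finset.mem_singleton] at hz
        rcases hz with rfl | rfl | rfl <;> simpa
      have h4 : ({s, n, y} : Finset V).card = 3 := by
        refine Finset.card_eq_three.2 ⟨s, n, y, ?_, ?_, hyn.symm, rfl⟩
        · rintro rfl; exact Set.disjoint_left.1 hFN hsF hnN
        · rintro rfl; exact Set.disjoint_left.1 hFN hsF hy
      have := Finset.card_le_card h3
      omega
    · intro h
      exact absurd (by simpa [N'] using hnN) h
  have hzero : ∑ u ∈ R, ∑ x ∈ F', ∑ y ∈ N', τ u x y = 0 :=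
    Finset.sum_eq_zero fun u hu => heven u (hRF hu)
  -- Pairs inside `R` are counted twice, so the even total equals the weight of the cut, which is
  -- one: a contradiction.
  have hsplit : ∑ u ∈ R, ∑ x ∈ F', ∑ y ∈ N', τ u x y =
      ∑ u ∈ R, ∑ x ∈ F' \ R, ∑ y ∈ N', τ u x y := by
    simp_rw [← Finset.sum_sdiff hRF (f := fun x => ∑ y ∈ N', τ _ x y)]
    rw [Finset.sum_add_distrib, sum_sum_eq_zero_of_symmetric (S := R), add_zero]
    · exact fun a b => Finset.sum_congr rfl fun y _ => triangleIndicator_swap_left _ _ _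
    · exact fun a => Finset.sum_eq_zero fun y _ => triangleIndicator_self_left _ _
  rw [hsplit, Finset.sum_eq_single w₂, Finset.sum_eq_single w₁, hone] at hzero
  · exact one_ne_zero hzero
  · intro x hx hne
    by_contra h
    exact hne (hleave _ hw₂R _ hx h).2
  · exact fun h => absurd hw₁R h
  · intro u hu hne
    refine Finset.sum_eq_zero fun x hx => ?_
    by_contra h
    exact hne (hleave _ hu _ hx h).1
  · exact fun h => absurd hw₂R h

end Separation

/-! ### Altitudes and moving frames -/

section Geometry

open scoped InnerProductSpace

theorem inner_altitude_left {p q : E3} (hpq : p ≠ q) (a : E3) :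
    ⟪q - p, altitude p q a⟫_ℝ = 0 := by
  have h : ⟪q - p, q - p⟫_ℝ ≠ 0 := by simpa [sub_eq_zero] using hpq.symm
  rw [altitude, inner_sub_right, inner_smul_right, div_mul_cancel₀ _ h, sub_self]

theorem inner_altitude_altitude {p q : E3} (hpq : p ≠ q) (a b : E3) :
    ⟪altitude p q a, altitude p q b⟫_ℝ = ⟪altitude p q a, b - p⟫_ℝ := by
  have h := inner_altitude_left hpq a
  rw [real_inner_comm] at h
  conv_lhs => rw [altitude.eq_def p q b]
  rw [inner_sub_right, inner_smul_right, h, mul_zero, sub_zero]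

theorem inner_eq_of_norm_eq {p q a p' q' a' : E3} (h₁ : ‖p - q‖ = ‖p' - q'‖)
    (h₂ : ‖p - a‖ = ‖p' - a'‖) (h₃ : ‖q - a‖ = ‖q' - a'‖) :
    ⟪q - p, a - p⟫_ℝ = ⟪q' - p', a' - p'⟫_ℝ := by
  have key : ∀ p q a : E3, ⟪q - p, a - p⟫_ℝ = (‖p - q‖ ^ 2 + ‖p - a‖ ^ 2 - ‖q - a‖ ^ 2) / 2 := by
    intro p q a
    have : q - a = (q - p) - (a - p) := by abel
    rw [this, norm_sub_sq_real (q - p), norm_sub_rev p q, norm_sub_rev p a]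
    ring
  rw [key, key, h₁, h₂, h₃]

theorem norm_altitude_sq {p q : E3} (hpq : p ≠ q) (a : E3) :
    ‖altitude p q a‖ ^ 2 = ‖p - a‖ ^ 2 - ⟪q - p, a - p⟫_ℝ ^ 2 / ‖p - q‖ ^ 2 := by
  rw [← real_inner_self_eq_norm_sq, inner_altitude_altitude hpq, altitude, inner_sub_left,
    inner_smul_left, real_inner_self_eq_norm_sq, real_inner_self_eq_norm_sq, norm_sub_rev p a,
    norm_sub_rev p q]
  simp
  ring

theorem norm_altitude_eq {p q a p' q' a' : E3} (hpq : p ≠ q) (hpq' : p' ≠ q')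
    (h₁ : ‖p - q‖ = ‖p' - q'‖) (h₂ : ‖p - a‖ = ‖p' - a'‖) (h₃ : ‖q - a‖ = ‖q' - a'‖) :
    ‖altitude p q a‖ = ‖altitude p' q' a'‖ := by
  have := norm_altitude_sq hpq a
  rw [h₁, h₂, inner_eq_of_norm_eq h₁ h₂ h₃, ← norm_altitude_sq hpq'] at this
  exact (sq_eq_sq₀ (norm_nonneg _) (norm_nonneg _)).1 this

theorem exists_orthonormalBasis_of_orthogonal {x y : E3} (hx : x ≠ 0) (hy : y ≠ 0)
    (hxy : ⟪x, y⟫_ℝ = 0) :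
    ∃ b : OrthonormalBasis (Fin 3) ℝ E3, b 0 = ‖x‖⁻¹ • x ∧ b 1 = ‖y‖⁻¹ • y := by
  have hx' : ‖x‖ ≠ 0 := norm_ne_zero_iff.2 hx
  have hy' : ‖y‖ ≠ 0 := norm_ne_zero_iff.2 hy
  have hyx : ⟪y, x⟫_ℝ = 0 := by rw [real_inner_comm]; exact hxy
  have ho : Orthonormal ℝ (Set.domRestrict {0, 1} (![‖x‖⁻¹ • x, ‖y‖⁻¹ • y, 0] : Fin 3 → E3)) := by
    constructor
    · rintro ⟨i, rfl | rfl⟩ <;> simp [Set.domRestrict, norm_smul, hx', hy']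
    · rintro ⟨i, rfl | rfl⟩ ⟨j, rfl | rfl⟩ hij <;>
        simp [Set.domRestrict, inner_smul_left, inner_smul_right, hxy, hyx] at hij ⊢
  obtain ⟨b, hb⟩ := ho.exists_orthonormalBasis_extension_of_card_eq (by simp)
  exact ⟨b, by simpa using hb 0 (by simp), by simpa using hb 1 (by simp)⟩

/-- A triangle spans a frame of the space: the first axis along the edge `pq`, the second one
along the altitude. -/
theorem exists_frame {p q a : E3} (hpq : p ≠ q) (ha : altitude p q a ≠ 0) :
    ∃ b : OrthonormalBasis (Fin 3) ℝ E3,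
      (∀ x, ⟪b 0, x⟫_ℝ = ⟪q - p, x⟫_ℝ / ‖p - q‖) ∧
      (∀ x, ⟪b 1, x⟫_ℝ = ⟪altitude p q a, x⟫_ℝ / ‖altitude p q a‖) ∧
      ⟪b 2, q - p⟫_ℝ = 0 ∧ ⟪b 2, a - p⟫_ℝ = 0 := by
  have hD : q - p ≠ 0 := sub_ne_zero.2 hpq.symm
  obtain ⟨b, h0, h1⟩ := exists_orthonormalBasis_of_orthogonal hD ha (inner_altitude_left hpq a)
  have h20 : ⟪b 2, b 0⟫_ℝ = 0 := b.orthonormal.2 (by decide)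
  have h21 : ⟪b 2, b 1⟫_ℝ = 0 := b.orthonormal.2 (by decide)
  rw [h0, inner_smul_right, mul_eq_zero, inv_eq_zero, norm_eq_zero, or_iff_right hD] at h20
  rw [h1, inner_smul_right, mul_eq_zero, inv_eq_zero, norm_eq_zero, or_iff_right ha] at h21
  refine ⟨b, fun x => ?_, fun x => ?_, h20, ?_⟩
  · rw [h0, real_inner_smul_left, norm_sub_rev p q]; ring
  · rw [h1, real_inner_smul_left]; ring
  · rw [altitude, inner_sub_right, inner_smul_right, h20, mul_zero, sub_zero] at h21
    exact h21

theorem infinite_range_of_preconnectedSpace {T : Type*} [TopologicalSpace T] [PreconnectedSpace T]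
    {c : T → ℝ} (hc : Continuous c) {t₁ t₂ : T} (h : c t₁ ≠ c t₂) : (Set.range c).Infinite := by
  have hpre := isPreconnected_range hc
  rcases lt_or_gt_of_ne h with h | h
  · exact (Set.Icc_infinite h).mono (hpre.Icc_subset ⟨_, rfl⟩ ⟨_, rfl⟩)
  · exact (Set.Icc_infinite h).mono (hpre.Icc_subset ⟨_, rfl⟩ ⟨_, rfl⟩)

end Geometry

/-! ### The zero-sum cycle -/

theorem theorem1 {V : Type*} [Finite V] [DecidableEq V]
    (K : AbstractSimplicialComplex V) (hK : IsTriangularPolyhedron K)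
    (ρ : V → E3) (hρ : IsRealization (oneSkeleton K) ρ)
    (f : Set.Ico (0 : ℝ) 1 → V → E3) (hf : IsFlex (oneSkeleton K) ρ f)
    (w₁ w₂ s n : V) (hw : (oneSkeleton K).Adj w₁ w₂)
    (hs : IsOppositeVertex K w₁ w₂ s) (hn : IsOppositeVertex K w₁ w₂ n) (hsn : s ≠ n)
    (hdih : ∃ t₁ t₂ : Set.Ico (0 : ℝ) 1,
      dihedralAngle (f t₁ w₁) (f t₁ w₂) (f t₁ s) (f t₁ n) ≠
        dihedralAngle (f t₂ w₁) (f t₂ w₂) (f t₂ s) (f t₂ n)) :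
    ∃ c : (oneSkeleton K).Walk w₁ w₁,
      c.IsCycle ∧ c.toSubgraph.IsInduced ∧
      s(w₁, w₂) ∈ c.edges ∧ s ∉ c.support ∧ n ∉ c.support ∧
      ∃ ε : Sym2 V → ℤˣ,
        (c.edges.map fun e => ((ε e : ℤ) : ℝ) * edgeLength ρ e).sum = 0 := by
  classical
  have := Fintype.ofFinite V
  obtain ⟨t₁, t₂, hdih⟩ := hdih
  have hlen : ∀ u v, (oneSkeleton K).Adj u v → ∀ t, ‖f t u - f t v‖ = edgeLength ρ s(u, v) := by
    intro u v huv t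
    have := hf.edgeLength_eq t s(u, v) huv
    rw [hf.start] at this
    exact this
  have hadj : ∀ x, IsOppositeVertex K w₁ w₂ x →
      (oneSkeleton K).Adj w₁ x ∧ (oneSkeleton K).Adj w₂ x := by
    intro x hx
    have : triangleIndicator K w₁ w₂ x ≠ 0 := by simp [triangleIndicator, hw.1, hx]
    exact (adj_of_triangleIndicator_ne_zero this).2
  have hne : ∀ t, f t w₁ ≠ f t w₂ := by
    intro t
    rw [← sub_ne_zero, ← norm_ne_zero_iff, hlen _ _ hw]
    exact norm_ne_zero_iff.2 (sub_ne_zero.2 (hρ _ _ hw))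
  have hinner : ∀ x, IsOppositeVertex K w₁ w₂ x → ∃ k, ∀ t,
      inner ℝ (f t w₂ - f t w₁) (f t x - f t w₁) = k := fun x hx =>
    ⟨_, fun t => inner_eq_of_norm_eq (p' := f t₁ w₁) (q' := f t₁ w₂) (a' := f t₁ x)
      (by simp only [hlen _ _ hw]) (by simp only [hlen _ _ (hadj x hx).1])
      (by simp only [hlen _ _ (hadj x hx).2])⟩
  have halt : ∀ x, IsOppositeVertex K w₁ w₂ x → ∃ k, ∀ t,
      ‖altitude (f t w₁) (f t w₂) (f t x)‖ = k := fun x hx =>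
    ⟨_, fun t => norm_altitude_eq (p' := f t₁ w₁) (q' := f t₁ w₂) (a' := f t₁ x) (hne _) (hne _)
      (by simp only [hlen _ _ hw]) (by simp only [hlen _ _ (hadj x hx).1])
      (by simp only [hlen _ _ (hadj x hx).2])⟩
  obtain ⟨is, his⟩ := hinner s hs
  obtain ⟨jn, hjn⟩ := hinner n hn
  obtain ⟨B, hB⟩ := halt s hs
  obtain ⟨C, hC⟩ := halt n hn
  -- A vanishing altitude would make the angle constantly `π / 2`.
  have hB0 : B ≠ 0 := by
    rintro rfl
    simp only [norm_eq_zero] at hB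
    exact hdih (by simp [dihedralAngle, hB])
  have halt0 : ∀ t, altitude (f t w₁) (f t w₂) (f t s) ≠ 0 := fun t => by
    rw [← norm_ne_zero_iff, hB]; exact hB0
  -- The frames need not depend continuously on `t`; continuity is only needed for `c`, which is
  -- defined without them.
  choose b hb0 hb1 hb2 hb2' using fun t => exists_frame (hne t) (halt0 t)
  set c : Set.Ico (0 : ℝ) 1 → ℝ := fun t =>
    inner ℝ (altitude (f t w₁) (f t w₂) (f t s)) (altitude (f t w₁) (f t w₂) (f t n)) with hc_def
  have hc : Continuous c := by
    have hfc : ∀ x, Continuous fun t => f t x := fun x => (continuous_apply x).comp hf.continuous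
    have hac : ∀ x, Continuous fun t => altitude (f t w₁) (f t w₂) (f t x) := by
      intro x
      have h1 : Continuous fun t => f t x - f t w₁ := (hfc x).sub (hfc w₁)
      have h2 : Continuous fun t => f t w₂ - f t w₁ := (hfc w₂).sub (hfc w₁)
      have h3 := (h2.inner (𝕜 := ℝ) h1).div₀ (h2.inner (𝕜 := ℝ) h2) fun t => by
        simpa [sub_eq_zero] using (hne t).symm
      exact h1.sub (h3.smul h2)
    exact (hac s).inner (hac n)
  -- The dihedral angle is `arccos (c / (B * C))` with constant `B` and `C`. So `c` varies, and with
  -- it the second coordinate `c / B` of `n`.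
  have hcne : c t₁ ≠ c t₂ := by
    intro h
    apply hdih
    simp only [dihedralAngle, InnerProductGeometry.angle, hB, hC]
    exact congrArg (fun z => Real.arccos (z / (B * C))) h
  have : PreconnectedSpace (Set.Ico (0 : ℝ) 1) := Subtype.preconnectedSpace isPreconnected_Ico
  have hcinf := infinite_range_of_preconnectedSpace hc hcne
  let X : Fin 3 → V → Set.Ico (0 : ℝ) 1 → ℝ := fun i w t => inner ℝ (b t i) (f t w - f t w₁)
  have hX0n : ∀ t, X 0 n t = jn / edgeLength ρ s(w₁, w₂) := fun t => by
    simp only [X]; rw [hb0, hjn, hlen _ _ hw]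
  have hsq : ∀ (t) (x : E3), ‖x‖ ^ 2 =
      inner ℝ (b t 0) x ^ 2 + inner ℝ (b t 1) x ^ 2 + inner ℝ (b t 2) x ^ 2 := by
    intro t x
    rw [← (b t).sum_sq_norm_inner_right x, Fin.sum_univ_three]
    simp
  have hX1n : ∀ t, X 1 n t = c t / B := fun t => by
    simp only [X]
    rw [hb1, hB, hc_def]
    simp only
    rw [inner_altitude_altitude (hne t)]
  have hX1s : ∀ t, X 1 s t = B := fun t => by
    simp only [X]
    rw [hb1, ← inner_altitude_altitude (hne t), real_inner_self_eq_norm_sq, hB]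
    field_simp
  obtain ⟨k, Γ, _, _, v, ι, x, p, q, hι, hxpq, hnN, hqs, hfin⟩ :=
    exists_degeneration (oneSkeleton K) (X 0) (X 1) (X 2) (edgeLength ρ) (n := n) (s := s)
      (a := jn / edgeLength ρ s(w₁, w₂))
      (b := edgeLength ρ s(w₁, n) ^ 2 - (jn / edgeLength ρ s(w₁, w₂)) ^ 2) (r := B)
      (by
        intro u w huw t
        rw [← hlen u w huw t, hsq t]
        simp only [X, ← inner_sub_right, sub_sub_sub_cancel_right])
      hX0n
      (by
        intro t
        rw [← hX0n t, ← hlen _ _ (hadj n hn).1 t, norm_sub_rev, hsq t]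
        simp only [X]; ring)
      (by
        rw [funext hX1n]
        intro hfinite
        refine hcinf ((hfinite.image fun z => z * B).subset ?_)
        rintro _ ⟨t, rfl⟩
        exact ⟨_, ⟨t, rfl⟩, div_mul_cancel₀ _ hB0⟩)
      hB0 hX1s (fun t => hb2' t)
  let F : Set V := {w | IsFinitePoint v (x w) (p w) (q w)}
  let N : Set V := {w | TendsToIsotropic v (x w) (p w) (q w)}
  let U : Set V := {w | w ∈ F ∧ v (q w) < 1}
  have hl1 : ∀ e, v (ι (edgeLength ρ e) ^ 2) ≤ 1 := fun e => by rw [← map_pow]; exact hι _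
  have hw₁F : w₁ ∈ F := hfin w₁ ⟨0, by simp [X]⟩ ⟨0, by simp [X]⟩ (by simp [X])
  have hw₂F : w₂ ∈ F := by
    refine hfin w₂ ⟨edgeLength ρ s(w₁, w₂), fun t => ?_⟩ ⟨0, fun t => ?_⟩ hb2
    · simp only [X]
      have h0 : ‖f t w₁ - f t w₂‖ ≠ 0 := norm_ne_zero_iff.2 (sub_ne_zero.2 (hne t))
      rw [hb0, real_inner_self_eq_norm_sq, ← hlen _ _ hw t, norm_sub_rev (f t w₂)]
      field_simp
    · simp only [X]
      rw [hb1, real_inner_comm, inner_altitude_left (hne t), zero_div]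
  have hsF : s ∈ F := by
    refine hfin s ⟨is / edgeLength ρ s(w₁, w₂), fun t => ?_⟩ ⟨B, hX1s⟩ hb2'
    simp only [X]
    rw [hb0, his, hlen _ _ hw]
  have hFN : Disjoint F N := by
    rw [Set.disjoint_left]
    intro w hwF hwN
    exact absurd hwN.one_lt (not_lt.2 hwF.p)
  have hU : ∀ u ∈ F, ∀ y ∈ N, (oneSkeleton K).Adj u y → u ∈ U := fun u hu y hy huy =>
    ⟨hu, hu.q_lt_one_of_tendsToIsotropic hy (hl1 _) (hxpq u y huy)⟩
  have hreach := hK.reachable_induceDeleteEdge hFN (U := U) (fun _ h => h.1) hU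
    (fun u hu y hy z hz huy huz hyz => TendsToIsotropic.of_adjacent hu (hU u hu y hy huy).2 hy hz
      (hl1 _) (hl1 _) (hxpq u z huz) (hxpq y z hyz)) hw hs hn hw₁F hw₂F hsF hnN
  obtain ⟨w, hcyc, hind, hmem, hwU⟩ := SimpleGraph.exists_induced_cycle
    (hU w₁ hw₁F n hnN (hadj n hn).1) hw hreach
  refine ⟨w, hcyc, hind, hmem, fun h => ?_, fun h => ?_, ?_⟩
  · exact absurd (hwU s h).2 (by rw [hqs]; exact lt_irrefl _)
  · exact Set.disjoint_left.1 hFN (hwU n h).1 hnN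
  · exact exists_zero_sum_signs ι hι (edgeLength ρ) x
      (fun a ha d hd had => ha.1.exists_unit_sub_lt_one ha.2 hd.1 hd.2 (hxpq a d had))
      w hcyc.edges_nodup hwU
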